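/- Let $A$ be an infinite set of atoms. Formulae are built from atoms and $\bot$ by $\wedge,\vee,\supset$. An atomic rule has the form $((P_1\Rightarrow q_1),\dots,(P_n\Rightarrow q_n))\Rightarrow r$ with $n\ge 0$, each $P_i$ a finite set of atoms and $q_i,r$ atoms; a base is a set of atomic rules (automatically countable if $A$ is countable). For a base $\mathcal B$, the relation $P\vdash_{\mathcal B}p$ between sets of atoms and atoms is generated by: $P\vdash_{\mathcal B}p$ if $p\in P$; and $P\vdash_{\mathcal B}r$ if a rule as above is in $\mathcal B$ and $P\cup P_i\vdash_{\mathcal B}q_i$ for all $i$. **Base-extension validity.** $\Vdash_{\mathcal B}\phi$ is defined by recursion on $\phi$: $\Vdash_{\mathcal B}p$ iff $\emptyset\vdash_{\mathcal B}p$; $\Vdash_{\mathcal B}\bot$ iff $\Vdash_{\mathcal B}p$ for all atoms $p$; $\Vdash_{\mathcal B}\phi\wedge\psi$ iff $\Vdash_{\mathcal B}\phi$ and $\Vdash_{\mathcal B}\psi$; $\Vdash_{\mathcal B}\phi\supset\psi$ iff $\phi\Vdash_{\mathcal B}\psi$; $\Vdash_{\mathcal B}\phi\vee\psi$ iff for every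 atom $p$ and every base $\mathcal C\supseteq\mathcal B$, $\phi\Vdash_{\mathcal C}p$ and $\psi\Vdash_{\mathcal C}p$ imply $\Vdash_{\mathcal C}p$; here $\theta\Vdash_{\mathcal B}\chi$ means that for every base $\mathcal C\supseteq\mathcal B$, $\Vdash_{\mathcal C}\theta$ implies $\Vdash_{\mathcal C}\chi$. For a finite set $\Gamma$ of formulae, $\Gamma\Vdash\phi$ means that for every base $\mathcal B$, if $\Vdash_{\mathcal B}\psi$ for all $\psi\in\Gamma$, then $\Vdash_{\mathcal B}\phi$. **Categorical validity.** A context $(X:P)$ is a finite list $x_1:p_1,\dots,x_m:p_m$ of variables with atoms. Derivation terms $(X:P)\vdash_{\mathcal B}\Phi:p$ are the variables $x_i:p_i$ and the terms $\Phi_{\mathcal R}(\Phi_1,\dots,\Phi_n):r$ for rules $\mathcal R\in\mathcal B$ as above, where $(X:P),(X_i:P_i)\vdash_{\mathcal B}\Phi_i:q_i$ and the variables $X_i$ (one for each element of $P_i$) become bound; terms are taken up to renaming of variables. Let $\mathcal W$ be the category whose objects are pairs $(\mathcal B,(X:P))$ and whose morphisms $(\mathcal B,(X:P))\to(\mathcal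 C,(Y:Q))$ exist only if $\mathcal C\subseteq\mathcal B$ and consist of a derivation $(X:P)\vdash_{\mathcal B}\Phi_j:q_j$ for each variable $y_j:q_j$ of $(Y:Q)$; identities are the variables, and composition is substitution. Write $h^w=\mathcal W(-,w)$. Define presheaves $⟦\phi⟧:\mathcal W^{op}\to\mathbf{Set}$ by: $⟦p⟧(\mathcal B,(X:P))$ is the set of derivations $(X:P)\vdash_{\mathcal B}\Phi:p$, on which morphisms act by substitution; $⟦\phi\wedge\psi⟧=⟦\phi⟧\times⟦\psi⟧$; $⟦\phi\supset\psi⟧=⟦\phi⟧\supset⟦\psi⟧$, where $(F\supset G)(w)=\mathrm{Nat}(h^w\times F,G)$; $⟦\phi\vee\psi⟧=\forall_p\big((⟦\phi⟧\supset⟦p⟧)\supset((⟦\psi⟧\supset⟦p⟧)\supset⟦p⟧)\big)$ and $⟦\bot⟧=\forall_p⟦p⟧$, where for a family $(K_p)_{p\in A}$ of presheaves $(\forall_pK_p)(w)=\prod_{p\in A}\mathrm{Nat}(h^w,K_p)$. For a finite set $\Gamma$ put $⟦\Gamma⟧=\prod_{\psi\in\Gamma}⟦\psi⟧$, and let $\Gamma\models\phi$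 mean that there is a natural transformation $⟦\Gamma⟧\to⟦\phi⟧$. **Proposition (Equivalence).** For every finite set $\Gamma$ of formulae and every formula $\phi$, $\Gamma\Vdash\phi$ if and only if $\Gamma\models\phi$. -/

import Mathlib

universe u

namespace BaseExt

noncomputable section

/-- Formulae of intuitionistic propositional logic over a set of atoms. -/
inductive Formula (Atom : Type u) : Type u
  | atom : Atom → Formula Atom
  | bot : Formula Atom
  | and : Formula Atom → Formula Atom → Formula Atom
  | or : Formula Atom → Formula Atom → Formula Atom
  | imp : Formula Atom → Formula Atom → Formula Atom

/-- An atomic rule `((P₁ ⇒ q₁), …, (Pₙ ⇒ qₙ)) ⇒ r`: the list of its premises `(Pᵢ, qᵢ)`, each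
`Pᵢ` a finite set of atoms (the discharged hypotheses), and its conclusion `r`. -/
structure AtomicRule (Atom : Type u) : Type u where
  prems : List (Finset Atom × Atom)
  concl : Atom

/-- A base is a set of atomic rules, ordered by inclusion. -/
abbrev Base (Atom : Type u) : Type u := Set (AtomicRule Atom)

/-- Over a countable set of atoms every base is automatically countable. -/
theorem Base.countable {Atom : Type u} [Countable Atom] (B : Base Atom) :
    Set.Countable B := by
  have hinj : Function.Injective
      (fun R : AtomicRule Atom => (R.prems, R.concl)) := by
    rintro ⟨a, b⟩ ⟨c, d⟩ h
    simpa using h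
  have : Countable (AtomicRule Atom) := hinj.countable
  exact Set.to_countable B

/-- Consequence for atoms with respect to a base, `P ⊢_B p`. -/
inductive Entails {Atom : Type u} (B : Base Atom) : Set Atom → Atom → Prop
  | ref {P : Set Atom} {p : Atom} : p ∈ P → Entails B P p
  | app {P : Set Atom} (R : AtomicRule Atom) : R ∈ B →
      (∀ i : Fin R.prems.length,
        Entails B (P ∪ ((R.prems.get i).1 : Set Atom)) (R.prems.get i).2) →
      Entails B P R.concl

/-- Validity in a base, `⊩_B φ`; hypothetical validity `θ ⊩_B χ`, which occurs in the clauses for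
implication and disjunction, is unfolded to: for every `C ⊇ B`, if `⊩_C θ` then `⊩_C χ`. -/
def ValidIn {Atom : Type u} : Formula Atom → Base Atom → Prop
  | .atom p, B => Entails B ∅ p
  | .bot, B => ∀ p : Atom, Entails B ∅ p
  | .and φ ψ, B => ValidIn φ B ∧ ValidIn ψ B
  | .or φ ψ, B => ∀ (p : Atom) (C : Base Atom), B ⊆ C →
      (∀ D : Base Atom, C ⊆ D → ValidIn φ D → Entails D ∅ p) →
      (∀ D : Base Atom, C ⊆ D → ValidIn ψ D → Entails D ∅ p) → Entails C ∅ p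
  | .imp φ ψ, B => ∀ C : Base Atom, B ⊆ C → ValidIn φ C → ValidIn ψ C

/-- Base-extension validity `Γ ⊩ φ`. -/
def Valid {Atom : Type u} (Γ : Finset (Formula Atom)) (φ : Formula Atom) : Prop :=
  ∀ B : Base Atom, (∀ ψ ∈ Γ, ValidIn ψ B) → ValidIn φ B

/-- A context `x₁ : p₁, …, xₘ : pₘ`, with variables represented by their positions. The same atom
may be the type of several variables. -/
abbrev Ctx (Atom : Type u) : Type u := List Atom

/-- The variables of type `p` in a context. -/
inductive Var {Atom : Type u} : Ctx Atom → Atom → Type u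
  | zero {p : Atom} {X : Ctx Atom} : Var (p :: X) p
  | succ {p q : Atom} {X : Ctx Atom} : Var X p → Var (q :: X) p

/-- Derivation terms `(X : P) ⊢_B Φ : p`: variables, and rule applications
`Φ_R(Φ₁, …, Φₙ)`, where `Φᵢ` lives in the context extended by one (bound) variable for each atom
in the set `Pᵢ`. -/
inductive Der {Atom : Type u} (B : Base Atom) : Ctx Atom → Atom → Type u
  | var {X : Ctx Atom} {p : Atom} : Var X p → Der B X p
  | app {X : Ctx Atom} (R : AtomicRule Atom) : R ∈ B →
      (∀ i : Fin R.prems.length,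
        Der B ((R.prems.get i).1.toList ++ X) (R.prems.get i).2) →
      Der B X R.concl

/-- Renamings of variables. -/
abbrev Ren {Atom : Type u} (X Y : Ctx Atom) : Type u := ∀ p : Atom, Var X p → Var Y p

/-- Simultaneous substitutions: a derivation from `Y` in `B` for every variable of `X`. -/
abbrev Subn {Atom : Type u} (B : Base Atom) (X Y : Ctx Atom) : Type u :=
  ∀ p : Atom, Var X p → Der B Y p

namespace Ren

variable {Atom : Type u} {X Y Z : Ctx Atom}

/-- Extension of a renaming by one variable. -/
def lift₁ (q : Atom) (ρ : Ren X Y) : Ren (q :: X) (q :: Y)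
  | _, .zero => .zero
  | _, .succ x => .succ (ρ _ x)

/-- Extension of a renaming by a list of variables. -/
def lift : (L : List Atom) → Ren X Y → Ren (L ++ X) (L ++ Y)
  | [], ρ => ρ
  | q :: L, ρ => lift₁ q (lift L ρ)

theorem lift_comp (L : List Atom) (ρ : Ren X Y) (τ : Ren Y Z) (p : Atom) (x : Var (L ++ X) p) :
    lift L τ p (lift L ρ p x) = lift L (fun p x => τ p (ρ p x)) p x := by
  induction L with
  | nil => rfl
  | cons q L ih =>
    cases x with
    | zero => rfl
    | succ x => exact congrArg Var.succ (ih x)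

end Ren

namespace Der

variable {Atom : Type u} {B C : Base Atom}

/-- Renaming the free variables of a derivation. -/
def rename {X : Ctx Atom} {p : Atom} (Φ : Der B X p) : ∀ {Y : Ctx Atom}, Ren X Y → Der B Y p :=
  match Φ with
  | .var x => fun ρ => .var (ρ _ x)
  | .app R h Φs => fun ρ => .app R h fun i => (Φs i).rename (ρ.lift _)

/-- A derivation in a base is also a derivation in every larger base. -/
def mono (hBC : B ⊆ C) {X : Ctx Atom} {p : Atom} : Der B X p → Der C X p
  | .var x => .var x
  | .app R h Φs => .app R (hBC h) fun i => (Φs i).mono hBC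

end Der

namespace Subn

variable {Atom : Type u} {B C : Base Atom} {X Y Z : Ctx Atom}

/-- Extension of a substitution by one variable. -/
def lift₁ (q : Atom) (σ : Subn B X Y) : Subn B (q :: X) (q :: Y)
  | _, .zero => .var .zero
  | _, .succ x => (σ _ x).rename fun _ y => .succ y

/-- Extension of a substitution by a list of variables. -/
def lift : (L : List Atom) → Subn B X Y → Subn B (L ++ X) (L ++ Y)
  | [], σ => σ
  | q :: L, σ => lift₁ q (lift L σ)

end Subn

namespace Der

variable {Atom : Type u} {B C D : Base Atom}

/-- The capture-avoiding simultaneous substitution `Φ[Φ₁/x₁, …, Φₘ/xₘ]`. -/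
def subst {X : Ctx Atom} {p : Atom} (Φ : Der B X p) : ∀ {Y : Ctx Atom}, Subn B X Y → Der B Y p :=
  match Φ with
  | .var x => fun σ => σ _ x
  | .app R h Φs => fun σ => .app R h fun i => (Φs i).subst (Subn.lift _ σ)

theorem rename_rename {X : Ctx Atom} {p : Atom} (Φ : Der B X p) :
    ∀ {Y Z : Ctx Atom} (ρ : Ren X Y) (τ : Ren Y Z),
      (Φ.rename ρ).rename τ = Φ.rename fun p x => τ p (ρ p x) := by
  induction Φ with
  | var x => intros; rfl
  | app R h Φs ih =>
    intro Y Z ρ τ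
    simp only [rename, ih]
    congr 1; funext i; congr 1; funext p x
    exact Ren.lift_comp _ ρ τ p x

theorem lift_rename (L : List Atom) {X Y Z : Ctx Atom} (ρ : Ren X Y) (σ : Subn B Y Z) (p : Atom)
    (x : Var (L ++ X) p) :
    Subn.lift L σ p (Ren.lift L ρ p x) = Subn.lift L (fun p x => σ p (ρ p x)) p x := by
  induction L with
  | nil => rfl
  | cons q L ih =>
    cases x with
    | zero => rfl
    | succ x => exact congrArg (fun Ψ => Der.rename Ψ _) (ih x)

theorem subst_rename {X : Ctx Atom} {p : Atom} (Φ : Der B X p) :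
    ∀ {Y Z : Ctx Atom} (ρ : Ren X Y) (σ : Subn B Y Z),
      (Φ.rename ρ).subst σ = Φ.subst fun p x => σ p (ρ p x) := by
  induction Φ with
  | var x => intros; rfl
  | app R h Φs ih =>
    intro Y Z ρ σ
    simp only [rename, subst, ih]
    congr 1; funext i; congr 1; funext p x
    exact lift_rename _ ρ σ p x

theorem rename_lift (L : List Atom) {X Y Z : Ctx Atom} (σ : Subn B X Y) (ρ : Ren Y Z) (p : Atom)
    (x : Var (L ++ X) p) :
    (Subn.lift L σ p x).rename (Ren.lift L ρ) = Subn.lift L (fun p x => (σ p x).rename ρ) p x := by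
  induction L with
  | nil => rfl
  | cons q L ih =>
    cases x with
    | zero => rfl
    | succ x =>
      change Der.rename (Der.rename _ _) _ = Der.rename _ _
      rw [rename_rename, ← ih, rename_rename]
      rfl

theorem rename_subst {X : Ctx Atom} {p : Atom} (Φ : Der B X p) :
    ∀ {Y Z : Ctx Atom} (σ : Subn B X Y) (ρ : Ren Y Z),
      (Φ.subst σ).rename ρ = Φ.subst fun p x => (σ p x).rename ρ := by
  induction Φ with
  | var x => intros; rfl
  | app R h Φs ih =>
    intro Y Z σ ρ
    simp only [rename, subst, ih]
    congr 1; funext i; congr 1; funext p x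
    exact rename_lift _ σ ρ p x

theorem subst_lift (L : List Atom) {X Y Z : Ctx Atom} (σ : Subn B X Y) (τ : Subn B Y Z) (p : Atom)
    (x : Var (L ++ X) p) :
    (Subn.lift L σ p x).subst (Subn.lift L τ) = Subn.lift L (fun p x => (σ p x).subst τ) p x := by
  induction L with
  | nil => rfl
  | cons q L ih =>
    cases x with
    | zero => rfl
    | succ x =>
      change Der.subst (Der.rename _ _) _ = Der.rename _ _
      rw [subst_rename, ← ih, rename_subst]
      rfl

theorem subst_subst {X : Ctx Atom} {p : Atom} (Φ : Der B X p) :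
    ∀ {Y Z : Ctx Atom} (σ : Subn B X Y) (τ : Subn B Y Z),
      (Φ.subst σ).subst τ = Φ.subst fun p x => (σ p x).subst τ := by
  induction Φ with
  | var x => intros; rfl
  | app R h Φs ih =>
    intro Y Z σ τ
    simp only [subst, ih]
    congr 1; funext i; congr 1; funext p x
    exact subst_lift _ σ τ p x

theorem lift_var (L : List Atom) {X : Ctx Atom} (p : Atom) (x : Var (L ++ X) p) :
    Subn.lift L (fun p (x : Var X p) => (Der.var x : Der B X p)) p x = Der.var x := by
  induction L with
  | nil => rfl
  | cons q L ih =>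
    cases x with
    | zero => rfl
    | succ x => exact congrArg (fun Ψ => Der.rename Ψ _) (ih x)

theorem subst_var {X : Ctx Atom} {p : Atom} (Φ : Der B X p) :
    (Φ.subst fun _ x => Der.var x) = Φ := by
  induction Φ with
  | var x => rfl
  | app R h Φs ih =>
    simp only [subst]
    congr 1; funext i
    conv_rhs => rw [← ih i]
    congr 1; funext p x
    exact lift_var _ p x

theorem mono_rename (h : B ⊆ C) {X : Ctx Atom} {p : Atom} (Φ : Der B X p) :
    ∀ {Y : Ctx Atom} (ρ : Ren X Y), (Φ.rename ρ).mono h = (Φ.mono h).rename ρ := by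
  induction Φ with
  | var x => intros; rfl
  | app R hR Φs ih =>
    intro Y ρ
    simp only [rename, mono, ih]

theorem mono_lift (h : B ⊆ C) (L : List Atom) {X Y : Ctx Atom} (σ : Subn B X Y) (p : Atom)
    (x : Var (L ++ X) p) :
    (Subn.lift L σ p x).mono h = Subn.lift L (fun p x => (σ p x).mono h) p x := by
  induction L with
  | nil => rfl
  | cons q L ih =>
    cases x with
    | zero => rfl
    | succ x =>
      change Der.mono h (Der.rename _ _) = Der.rename _ _
      rw [mono_rename, ← ih]

theorem mono_subst (h : B ⊆ C) {X : Ctx Atom} {p : Atom} (Φ : Der B X p) :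
    ∀ {Y : Ctx Atom} (σ : Subn B X Y),
      (Φ.subst σ).mono h = (Φ.mono h).subst fun p x => (σ p x).mono h := by
  induction Φ with
  | var x => intros; rfl
  | app R hR Φs ih =>
    intro Y σ
    simp only [subst, mono, ih]
    congr 1; funext i; congr 1; funext p x
    exact mono_lift h _ σ p x

theorem mono_mono (h : B ⊆ C) (k : C ⊆ D) {X : Ctx Atom} {p : Atom} (Φ : Der B X p) :
    (Φ.mono h).mono k = Φ.mono (h.trans k) := by
  induction Φ with
  | var x => rfl
  | app R hR Φs ih => simp only [mono, ih]

theorem mono_self (h : B ⊆ B) {X : Ctx Atom} {p : Atom} (Φ : Der B X p) : Φ.mono h = Φ := by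
  induction Φ with
  | var x => rfl
  | app R hR Φs ih => simp only [mono, ih]

end Der

/-- The objects `(B, (X : P))` of the category of bases and contexts. -/
structure World (Atom : Type u) : Type u where
  base : Base Atom
  ctx : Ctx Atom

/-- A morphism `(B, (X : P)) ⟶ (C, (Y : Q))`: an inclusion `C ⊆ B` and, for each variable of `Y`,
a derivation in `B` of its atom from `(X : P)`. -/
@[ext]
structure World.Hom {Atom : Type u} (v w : World Atom) : Type u where
  incl : w.base ⊆ v.base
  ders : ∀ p : Atom, Var w.ctx p → Der v.base v.ctx p

open CategoryTheory Opposite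

/-- The category of bases and contexts: identities are variables, composition is substitution. -/
instance World.category {Atom : Type u} : SmallCategory (World Atom) where
  Hom := World.Hom
  id _ := ⟨Set.Subset.rfl, fun _ x => .var x⟩
  comp f g := ⟨g.incl.trans f.incl, fun p z => ((g.ders p z).mono f.incl).subst f.ders⟩
  id_comp f := by
    apply World.Hom.ext
    funext p x
    simp only [Der.mono_self]
    exact Der.subst_var _
  comp_id f := by
    apply World.Hom.ext
    rfl
  assoc f g h := by
    apply World.Hom.ext
    funext p x
    simp only [Der.mono_subst, Der.mono_mono, Der.subst_subst]

/-- Presheaves on the category of bases and contexts. -/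
abbrev Psh (Atom : Type u) : Type (u + 1) := (World Atom)ᵒᵖ ⥤ Type u

namespace Psh

variable {Atom : Type u}

/-- The interpretation of an atom: derivations of it, acted upon by substitution. -/
def atom (p : Atom) : Psh Atom where
  obj w := Der w.unop.base w.unop.ctx p
  map f := TypeCat.ofHom fun Φ => (Φ.mono f.unop.incl).subst f.unop.ders
  map_id w := by
    ext Φ
    change (Der.mono _ Φ).subst (fun _ x => .var x) = Φ
    rw [Der.mono_self, Der.subst_var]
  map_comp f g := by
    ext Φ
    change (Der.mono _ Φ).subst
        (fun p z => ((f.unop.ders p z).mono g.unop.incl).subst g.unop.ders) =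
      (((Φ.mono f.unop.incl).subst f.unop.ders).mono g.unop.incl).subst g.unop.ders
    rw [Der.mono_subst, Der.mono_mono, Der.subst_subst]

/-- The exponential presheaf: `(F ⊃ G)(w) = Nat(Hom(-, w) × F, G)`. -/
def exp (F G : Psh Atom) : Psh Atom where
  obj w := FunctorToTypes.prod (yoneda.obj w.unop) F ⟶ G
  map f := TypeCat.ofHom fun α =>
    FunctorToTypes.prod.lift (FunctorToTypes.prod.fst ≫ yoneda.map f.unop)
      FunctorToTypes.prod.snd ≫ α
  map_id w := by
    ext α : 3
    change FunctorToTypes.prod.lift (FunctorToTypes.prod.fst ≫ yoneda.map (𝟙 w.unop))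
      FunctorToTypes.prod.snd ≫ α = α
    rw [yoneda.map_id]
    rfl
  map_comp f g := by
    ext α : 3
    change FunctorToTypes.prod.lift (FunctorToTypes.prod.fst ≫ yoneda.map (g.unop ≫ f.unop))
      FunctorToTypes.prod.snd ≫ α = _
    rw [yoneda.map_comp]
    rfl

/-- Quantification over atoms: `(∀ K)(w)` is the set of natural transformations from
`Hom(-, w)`, regarded as a functor on `Wᵒᵖ × A` that is constant in the discrete category `A` of
atoms, to `K`, that is, the set of families of natural transformations `Hom(-, w) ⟶ K(-, p)`. -/
def all (K : Atom → Psh Atom) : Psh Atom where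
  obj w := ∀ p : Atom, (yoneda.obj w.unop ⟶ K p)
  map f := TypeCat.ofHom fun α p => yoneda.map f.unop ≫ α p
  map_id w := by
    ext α : 3
    funext p
    change yoneda.map (𝟙 w.unop) ≫ α p = α p
    rw [yoneda.map_id, Category.id_comp]
  map_comp f g := by
    ext α : 3
    funext p
    change yoneda.map (g.unop ≫ f.unop) ≫ α p = yoneda.map g.unop ≫ yoneda.map f.unop ≫ α p
    rw [yoneda.map_comp, Category.assoc]

/-- The product of a family of presheaves, computed pointwise. -/
def pi {ι : Type u} (F : ι → Psh Atom) : Psh Atom where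
  obj w := ∀ i : ι, (F i).obj w
  map f := TypeCat.ofHom fun a i => (F i).map f (a i)
  map_id w := by
    ext a : 3
    funext i
    simp
  map_comp f g := by
    ext a : 3
    funext i
    simp

end Psh

/-- The interpretation `⟦φ⟧` of a formula as a presheaf. -/
def sem {Atom : Type u} : Formula Atom → Psh Atom
  | .atom p => Psh.atom p
  | .bot => Psh.all fun p => Psh.atom p
  | .and φ ψ => FunctorToTypes.prod (sem φ) (sem ψ)
  | .or φ ψ => Psh.all fun p =>
      Psh.exp (Psh.exp (sem φ) (Psh.atom p))
        (Psh.exp (Psh.exp (sem ψ) (Psh.atom p)) (Psh.atom p))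
  | .imp φ ψ => Psh.exp (sem φ) (sem ψ)

/-- The interpretation `⟦Γ⟧` of a finite set of formulae: the product of the `⟦ψ⟧`, `ψ ∈ Γ`. -/
def semCtx {Atom : Type u} (Γ : Finset (Formula Atom)) : Psh Atom :=
  Psh.pi fun ψ : {ψ : Formula Atom // ψ ∈ Γ} => sem ψ.1

/-- Categorical base-extension validity `Γ ⊨ φ`: there is a natural transformation `⟦Γ⟧ ⟶ ⟦φ⟧`. -/
def CatValid {Atom : Type u} (Γ : Finset (Formula Atom)) (φ : Formula Atom) : Prop :=
  Nonempty (semCtx Γ ⟶ sem φ)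

end

end BaseExt

namespace BaseExt

open CategoryTheory Opposite

noncomputable section

/-! ### Consequence for atoms -/

section Atoms

variable {Atom : Type u}

/-! Both notions of validity are instances of one interpretation of formulae in a frame, in which
`⊥` and `∨` are encoded by quantifying over atoms. Base-extension validity is the inequality `⨅ Γ ≤
φ` in the lower sets of bases ordered by reverse inclusion. Categorical validity is the same
inequality in the lower sets of presheaves preordered by existence of a natural transformation: only
existence matters, and `below` carries the presheaf operations to the frame operations
(`below_sem`).

It remains to compare two valuations `u` and `v`. The only property needed of the source is
genericity (`IsGeneric`): each base `B` has an element `n` below which its rules hold, while any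
inequality between atoms that holds under `n` is already derivable in `B`.

Given a sequent, encode the finitely many subformulae by atoms, fresh ones for the compound
formulae, and let `B` consist of the natural deduction rules for these codes. Below `n` every
subformula agrees with its code (`le_interp_iff_le_encode`), so a sequent valid under `u` yields an
atomic derivation in `B`. Decoding atoms as formulae makes all rules of `B` sound under any `v`
(`ruleVal_decode_eq_top`), so the derivation establishes the sequent there
(`IsGeneric.iInf_interp_le`). Both valuations are generic, which gives both directions. -/

theorem Entails.weaken {B C : Base Atom} (hBC : B ⊆ C) {P : Set Atom} {p : Atom}
    (h : Entails B P p) : ∀ {Q : Set Atom}, P ⊆ Q → Entails C Q p := by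
  induction h with
  | ref hp => exact fun hPQ => .ref (hPQ hp)
  | app R hR _ ih =>
    exact fun hPQ => .app R (hBC hR) fun i => ih i (Set.union_subset_union_left _ hPQ)

/-- The base of the rules `⇒ a` without premises, for `a ∈ P`. -/
def Base.facts (P : Set Atom) : Base Atom := {R | R.prems = [] ∧ R.concl ∈ P}

/-- Each use of an added axiom becomes a use of a hypothesis. Extending a base by facts thus
replaces assuming atoms, the device behind genericity of `baseVal`. -/
theorem Entails.of_union_facts {B : Base Atom} {P Q : Set Atom} {p : Atom}
    (h : Entails (B ∪ Base.facts P) Q p) : Entails B (Q ∪ P) p := by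
  induction h with
  | ref hp => exact .ref (Or.inl hp)
  | app R hR _ ih =>
    rcases hR with hR | hR
    · refine .app R hR fun i => (ih i).weaken subset_rfl ?_
      rw [Set.union_right_comm]
    · exact .ref (Or.inr hR.2)

theorem Entails.of_mem_facts {B : Base Atom} {P : Set Atom} {a : Atom} (ha : a ∈ P) :
    Entails (B ∪ Base.facts P) ∅ a :=
  .app ⟨[], a⟩ (Or.inr ⟨rfl, ha⟩) fun i => i.elim0

theorem Var.mem {X : Ctx Atom} {p : Atom} (x : Var X p) : p ∈ X := by
  induction x with
  | zero => exact List.mem_cons_self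
  | succ _ ih => exact List.mem_cons_of_mem _ ih

theorem Var.nonempty_of_mem {X : Ctx Atom} {p : Atom} (h : p ∈ X) : Nonempty (Var X p) := by
  induction X with
  | nil => simp at h
  | cons q X ih =>
    rcases List.mem_cons.1 h with rfl | h
    · exact ⟨.zero⟩
    · exact (ih h).map .succ

theorem Der.entails {B : Base Atom} {X : Ctx Atom} {p : Atom} (Φ : Der B X p) :
    Entails B {a | a ∈ X} p := by
  induction Φ with
  | var x => exact .ref x.mem
  | app R hR _ ih =>
    refine .app R hR fun i => (ih i).weaken subset_rfl fun a ha => ?_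
    rcases List.mem_append.1 ha with ha | ha
    · exact Or.inr (by simpa using ha)
    · exact Or.inl ha

end Atoms

/-! ### Interpretation in a frame -/

section Frame

variable {Atom : Type u} {H : Type*} [Order.Frame H]

/-- The interpretation of formulae in a frame, with the second-order encodings of `⊥` and `∨` in
which the quantifier ranges over atoms. -/
def interp (v : Atom → H) : Formula Atom → H
  | .atom p => v p
  | .bot => ⨅ p, v p
  | .and φ ψ => interp v φ ⊓ interp v ψ
  | .or φ ψ => ⨅ p, (interp v φ ⇨ v p) ⇨ (interp v ψ ⇨ v p) ⇨ v p
  | .imp φ ψ => interp v φ ⇨ interp v ψ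

/-- The value of an atomic rule, read as an implication. -/
def ruleVal (v : Atom → H) (R : AtomicRule Atom) : H :=
  (⨅ s ∈ R.prems, (⨅ a ∈ s.1, v a) ⇨ v s.2) ⇨ v R.concl

/-- Soundness of atomic derivations, with `n` standing for the base. It is used at `n = ⊤` with
decoded atoms. -/
theorem inf_iInf_le_of_entails {v : Atom → H} {B : Base Atom} {n : H}
    (hn : ∀ R ∈ B, n ≤ ruleVal v R) {P : Set Atom} {p : Atom} (h : Entails B P p) :
    n ⊓ ⨅ a ∈ P, v a ≤ v p := by
  induction h with
  | ref hp => exact inf_le_right.trans (iInf₂_le _ hp)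
  | @app P R hR _ ih =>
    refine (le_inf ?_ (inf_le_left.trans (hn R hR))).trans inf_himp_le
    refine le_iInf₂ fun s hs => ?_
    obtain ⟨i, rfl⟩ := List.get_of_mem hs
    rw [le_himp_iff, inf_assoc]
    refine le_trans (inf_le_inf_left n ?_) (ih i)
    rw [iInf_union]
    simp

theorem iInf_mem_cons {ι : Type*} (f : ι → H) (i : ι) (l : List ι) :
    ⨅ j ∈ i :: l, f j = f i ⊓ ⨅ j ∈ l, f j := by
  simp [iInf_or, iInf_inf_eq]

theorem le_himp_iff_forall_le {a b c : H} : a ≤ b ⇨ c ↔ ∀ x ≤ a, x ≤ b → x ≤ c :=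
  ⟨fun h _ ha hb => (le_inf (ha.trans h) hb).trans himp_inf_le,
    fun h => le_himp_iff.2 (h _ inf_le_left inf_le_right)⟩

/-- The infimum encoding `⊥` ranges over atoms only, so ex falso for a compound `χ` takes an
induction. -/
theorem interp_bot_le (v : Atom → H) (χ : Formula Atom) : interp v .bot ≤ interp v χ := by
  induction χ with
  | atom p => exact iInf_le _ p
  | bot => exact le_rfl
  | and _ _ ihα ihβ => exact le_inf ihα ihβ
  | imp _ _ _ ihβ => exact ihβ.trans le_himp
  | or _ _ _ _ => exact le_iInf fun p => (iInf_le _ p).trans (le_himp.trans le_himp)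

/-- The encoding of `∨` gives elimination into atoms directly; other conclusions are reduced to
their components. A disjunctive `χ` needs no induction hypothesis, since its encoding is an infimum
of iterated implications ending in atoms. -/
theorem interp_or_elim (v : Atom → H) (φ ψ χ : Formula Atom) :
    interp v (.or φ ψ) ⊓ (interp v φ ⇨ interp v χ) ⊓ (interp v ψ ⇨ interp v χ) ≤
      interp v χ := by
  have elim_atom (p : Atom) :
      interp v (.or φ ψ) ⊓ (interp v φ ⇨ v p) ⊓ (interp v ψ ⇨ v p) ≤ v p := by
    rw [← le_himp_iff, ← le_himp_iff]
    exact iInf_le _ p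
  induction χ with
  | atom p => exact elim_atom p
  | bot =>
    refine le_iInf fun p => le_trans ?_ (elim_atom p)
    gcongr <;> exact iInf_le _ p
  | and α β ihα ihβ =>
    refine le_inf (le_trans ?_ ihα) (le_trans ?_ ihβ)
    · gcongr <;> exact inf_le_left
    · gcongr <;> exact inf_le_right
  | imp α β _ ihβ =>
    refine le_himp_iff.2 (le_trans ?_ ihβ)
    have key (x : H) : (x ⇨ interp v (.imp α β)) ⊓ interp v α ≤ x ⇨ interp v β := by
      rw [interp, himp_left_comm]
      exact himp_inf_le
    refine le_inf (le_inf ?_ ?_) ?_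
    · exact inf_le_left.trans (inf_le_left.trans inf_le_left)
    · exact (inf_le_inf_right _ (inf_le_left.trans inf_le_right)).trans (key _)
    · exact (inf_le_inf_right _ inf_le_right).trans (key _)
  | or α β _ _ =>
    refine le_iInf fun p => le_himp_iff.2 (le_himp_iff.2 (le_trans ?_ (elim_atom p)))
    have key (x : H) : (x ⇨ interp v (.or α β)) ⊓ (interp v α ⇨ v p) ⊓ (interp v β ⇨ v p) ≤
        x ⇨ v p := by
      rw [← le_himp_iff, ← le_himp_iff, himp_left_comm _ x, himp_left_comm _ x]
      exact himp_le_himp_left (iInf_le _ p)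
    refine le_inf (le_inf ?_ ?_) ?_
    · exact inf_le_left.trans (inf_le_left.trans (inf_le_left.trans inf_le_left))
    · refine le_trans (inf_le_inf_right _ (inf_le_inf_right _ ?_)) (key _)
      exact inf_le_left.trans inf_le_right
    · exact le_trans (inf_le_inf_right _ (inf_le_inf_right _ inf_le_right)) (key _)

end Frame

/-! ### The base that simulates natural deduction -/

section Simulation

variable {Atom : Type u}

/-- Closure of a set of formulae under immediate subformulae. -/
structure SubClosed (T : Set (Formula Atom)) : Prop where
  and {φ ψ} : Formula.and φ ψ ∈ T → φ ∈ T ∧ ψ ∈ T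
  or {φ ψ} : Formula.or φ ψ ∈ T → φ ∈ T ∧ ψ ∈ T
  imp {φ ψ} : Formula.imp φ ψ ∈ T → φ ∈ T ∧ ψ ∈ T

theorem SubClosed.union {S T : Set (Formula Atom)} (hS : SubClosed S) (hT : SubClosed T) :
    SubClosed (S ∪ T) where
  and h := h.elim (fun h => ⟨.inl (hS.and h).1, .inl (hS.and h).2⟩)
    fun h => ⟨.inr (hT.and h).1, .inr (hT.and h).2⟩
  or h := h.elim (fun h => ⟨.inl (hS.or h).1, .inl (hS.or h).2⟩)
    fun h => ⟨.inr (hT.or h).1, .inr (hT.or h).2⟩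
  imp h := h.elim (fun h => ⟨.inl (hS.imp h).1, .inl (hS.imp h).2⟩)
    fun h => ⟨.inr (hT.imp h).1, .inr (hT.imp h).2⟩

theorem exists_finite_subClosed (φ : Formula Atom) :
    ∃ T : Set (Formula Atom), T.Finite ∧ SubClosed T ∧ φ ∈ T := by
  induction φ with
  | atom p => exact ⟨{.atom p}, Set.finite_singleton _, ⟨by simp, by simp, by simp⟩, rfl⟩
  | bot => exact ⟨{.bot}, Set.finite_singleton _, ⟨by simp, by simp, by simp⟩, rfl⟩
  | and φ ψ ihφ ihψ | or φ ψ ihφ ihψ | imp φ ψ ihφ ihψ =>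
    obtain ⟨S, hSf, hS, hφ⟩ := ihφ
    obtain ⟨T, hTf, hT, hψ⟩ := ihψ
    have hST := hS.union hT
    refine ⟨insert _ (S ∪ T), (hSf.union hTf).insert _, ⟨?_, ?_, ?_⟩, Set.mem_insert _ _⟩ <;>
      intro α β h <;> rcases h with h | h
    all_goals first
      | (cases h; done)
      | (cases h; exact ⟨.inr (.inl hφ), .inr (.inr hψ)⟩)
      | exact (hST.and h).imp .inr .inr
      | exact (hST.or h).imp .inr .inr
      | exact (hST.imp h).imp .inr .inr

theorem exists_finite_subClosed_superset (Γ : Finset (Formula Atom)) :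
    ∃ T : Set (Formula Atom), T.Finite ∧ SubClosed T ∧ ∀ ψ ∈ Γ, ψ ∈ T := by
  classical
  induction Γ using Finset.induction_on with
  | empty => exact ⟨∅, Set.finite_empty, ⟨by simp, by simp, by simp⟩, by simp⟩
  | insert φ Γ _ ih =>
    obtain ⟨S, hSf, hS, hφ⟩ := exists_finite_subClosed φ
    obtain ⟨T, hTf, hT, hΓ⟩ := ih
    refine ⟨S ∪ T, hSf.union hTf, hS.union hT, fun ψ hψ => ?_⟩
    rcases Finset.mem_insert.1 hψ with rfl | hψ
    · exact .inl hφ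
    · exact .inr (hΓ ψ hψ)

/-- A finite set of formulae can be encoded by atoms, the compound formulae by fresh ones. -/
theorem exists_encoding [Infinite Atom] {T : Set (Formula Atom)} (hT : T.Finite) :
    ∃ (e : Formula Atom → Atom) (d : Atom → Formula Atom),
      (∀ χ ∈ T, d (e χ) = χ) ∧ ∀ p, e (.atom p) = p := by
  classical
  -- Codes of compound formulae are taken outside `S`, since every atom must be its own code.
  let S : Set Atom := {p | Formula.atom p ∈ T}
  have hS : S.Finite := hT.preimage fun _ _ _ _ h => by injection h
  have : Infinite ↥Sᶜ := hS.infinite_compl.to_subtype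
  have : Finite T := hT
  obtain ⟨k, ⟨f⟩⟩ := Finite.exists_equiv_fin T
  let g : T → ↥Sᶜ := fun χ => Infinite.natEmbedding ↥Sᶜ (f χ)
  have hg : Function.Injective g := fun χ χ' h =>
    f.injective (Fin.ext ((Infinite.natEmbedding ↥Sᶜ).injective h))
  let c : Formula Atom → Atom := fun χ =>
    if h : χ ∈ T then (g ⟨χ, h⟩ : Atom) else Classical.arbitrary Atom
  have hc {χ : Formula Atom} (h : χ ∈ T) : c χ = g ⟨χ, h⟩ := dif_pos h
  have hcS {χ : Formula Atom} (h : χ ∈ T) : c χ ∉ S := by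
    rw [hc h]
    exact (g ⟨χ, h⟩).2
  have hcinj {χ χ' : Formula Atom} (h : χ ∈ T) (h' : χ' ∈ T) (he : c χ = c χ') : χ = χ' := by
    rw [hc h, hc h'] at he
    simpa using hg (Subtype.ext he)
  have hclash {p : Atom} {χ : Formula Atom} (hp : p ∈ S) (h : χ ∈ T) (heq : p = c χ) : False :=
    hcS h (heq ▸ hp)
  let e : Formula Atom → Atom := fun χ => match χ with
    | .atom p => p
    | χ => c χ
  have he : Set.InjOn e T := by
    intro χ h χ' h' hχ
    cases χ <;> cases χ'
    case atom.atom => exact congrArg _ hχ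
    all_goals first
      | exact hcinj h h' hχ
      | exact (hclash h h' hχ).elim
      | exact (hclash h' h hχ.symm).elim
  have : Nonempty (Formula Atom) := ⟨.bot⟩
  -- Decoding inverts `e` on `T`; on atoms that are not codes its value is an arbitrary formula.
  exact ⟨e, Function.invFunOn e T, fun χ h => he.leftInvOn_invFunOn h, fun p => rfl⟩

/-- The rules of natural deduction for the formulae in `T`, each formula being replaced by the
atom that encodes it. -/
inductive SimRule (e : Formula Atom → Atom) (T : Set (Formula Atom)) : Base Atom
  | andI {φ ψ} : Formula.and φ ψ ∈ T → SimRule e T ⟨[(∅, e φ), (∅, e ψ)], e (.and φ ψ)⟩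
  | andE₁ {φ ψ} : Formula.and φ ψ ∈ T → SimRule e T ⟨[(∅, e (.and φ ψ))], e φ⟩
  | andE₂ {φ ψ} : Formula.and φ ψ ∈ T → SimRule e T ⟨[(∅, e (.and φ ψ))], e ψ⟩
  | impI {φ ψ} : Formula.imp φ ψ ∈ T → SimRule e T ⟨[({e φ}, e ψ)], e (.imp φ ψ)⟩
  | impE {φ ψ} : Formula.imp φ ψ ∈ T → SimRule e T ⟨[(∅, e (.imp φ ψ)), (∅, e φ)], e ψ⟩
  | orI₁ {φ ψ} : Formula.or φ ψ ∈ T → SimRule e T ⟨[(∅, e φ)], e (.or φ ψ)⟩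
  | orI₂ {φ ψ} : Formula.or φ ψ ∈ T → SimRule e T ⟨[(∅, e ψ)], e (.or φ ψ)⟩
  | orE {φ ψ} (r : Atom) : Formula.or φ ψ ∈ T →
      SimRule e T ⟨[(∅, e (.or φ ψ)), ({e φ}, r), ({e ψ}, r)], r⟩
  | botE (r : Atom) : Formula.bot ∈ T → SimRule e T ⟨[(∅, e .bot)], r⟩

variable {e : Formula Atom → Atom} {T : Set (Formula Atom)}

/-- This is soundness of natural deduction in a frame. In `orE` and `botE` the conclusion `r` is any
atom and decodes to an arbitrary formula, possibly outside `T`, hence the elimination lemmas for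
every `χ`. -/
theorem ruleVal_decode_eq_top {H : Type*} [Order.Frame H] (v : Atom → H) {d : Atom → Formula Atom}
    (hT : SubClosed T) (hd : ∀ χ ∈ T, d (e χ) = χ) {R : AtomicRule Atom} (hR : R ∈ SimRule e T) :
    ruleVal (fun a => interp v (d a)) R = ⊤ := by
  rw [ruleVal, himp_eq_top_iff]
  cases hR with
  | andI h =>
    have hs := hT.and h
    simp [-List.mem_cons, iInf_mem_cons, hd _ h, hd _ hs.1, hd _ hs.2, interp]
  | andE₁ h | andE₂ h =>
    have hs := hT.and h
    simp [hd _ h, hd _ hs.1, hd _ hs.2, interp]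
  | impI h =>
    have hs := hT.imp h
    simp [hd _ h, hd _ hs.1, hd _ hs.2, interp]
  | impE h =>
    have hs := hT.imp h
    simp [-List.mem_cons, iInf_mem_cons, hd _ h, hd _ hs.1, hd _ hs.2, interp]
  | orI₁ h =>
    have hs := hT.or h
    simp only [List.mem_singleton, iInf_iInf_eq_left, Finset.notMem_empty, iInf_false, iInf_top,
      top_himp, hd _ h, hd _ hs.1, interp]
    refine le_iInf fun p => le_himp_iff.2 ?_
    exact inf_himp_le.trans le_himp
  | orI₂ h =>
    have hs := hT.or h
    simp only [List.mem_singleton, iInf_iInf_eq_left, Finset.notMem_empty, iInf_false, iInf_top,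
      top_himp, hd _ h, hd _ hs.2, interp]
    refine le_iInf fun p => le_himp_iff.2 (le_himp_iff.2 ?_)
    exact (inf_le_inf_right _ inf_le_left).trans inf_himp_le
  | @orE φ ψ r h =>
    have hs := hT.or h
    simpa [-List.mem_cons, iInf_mem_cons, hd _ h, hd _ hs.1, hd _ hs.2, inf_assoc] using
      interp_or_elim v φ ψ (d r)
  | botE r h =>
    simpa [hd _ h] using interp_bot_le v (d r)

/-- In a frame in which the simulating base is valid at `n`, a formula is equivalent below `n` to
the atom that encodes it. -/
theorem le_interp_iff_le_encode {K : Type*} [Order.Frame K] {u : Atom → K} {n : K}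
    (hT : SubClosed T) (he : ∀ p, e (.atom p) = p) (hn : ∀ R ∈ SimRule e T, n ≤ ruleVal u R)
    {χ : Formula Atom} (hχ : χ ∈ T) {x : K} (hx : x ≤ n) :
    x ≤ interp u χ ↔ x ≤ u (e χ) := by
  have apply_rule {R : AtomicRule Atom} (hR : R ∈ SimRule e T) {x : K} (hx : x ≤ n)
      (h : x ≤ ⨅ s ∈ R.prems, (⨅ a ∈ s.1, u a) ⇨ u s.2) : x ≤ u R.concl :=
    (le_inf (hx.trans (hn R hR)) h).trans himp_inf_le
  -- Implications are tested on all elements below `x`, so the induction hypotheses are needed at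
  -- every element below `n`.
  induction χ generalizing x with
  | atom p => rw [he, interp]
  | bot =>
    refine ⟨fun h => h.trans (iInf_le _ _), fun h => le_iInf fun r => ?_⟩
    exact apply_rule (.botE r hχ) hx (by simpa using h)
  | and φ ψ ihφ ihψ =>
    obtain ⟨hφ, hψ⟩ := hT.and hχ
    rw [interp, le_inf_iff]
    refine (and_congr (ihφ hφ hx) (ihψ hψ hx)).trans ⟨fun h => apply_rule (.andI hχ) hx ?_, fun h => ⟨?_, ?_⟩⟩
    · simpa [-List.mem_cons, iInf_mem_cons] using h
    · exact apply_rule (.andE₁ hχ) hx (by simpa using h)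
    · exact apply_rule (.andE₂ hχ) hx (by simpa using h)
  | imp φ ψ ihφ ihψ =>
    obtain ⟨hφ, hψ⟩ := hT.imp hχ
    rw [interp, le_himp_iff_forall_le]
    refine ⟨fun h => apply_rule (.impI hχ) hx ?_, fun h y hy hyφ => ?_⟩
    · simp only [List.mem_singleton, iInf_iInf_eq_left, Finset.mem_singleton]
      refine le_himp_iff_forall_le.2 fun y hy hyφ => ?_
      exact (ihψ hψ (hy.trans hx)).1 (h y hy ((ihφ hφ (hy.trans hx)).2 hyφ))
    · have hyn := hy.trans hx
      refine (ihψ hψ hyn).2 (apply_rule (.impE hχ) hyn ?_)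
      simpa [-List.mem_cons, iInf_mem_cons] using ⟨hy.trans h, (ihφ hφ hyn).1 hyφ⟩
  | or φ ψ ihφ ihψ =>
    obtain ⟨hφ, hψ⟩ := hT.or hχ
    rw [interp]
    simp only [le_iInf_iff, himp_himp, le_himp_iff_forall_le (c := u _)]
    -- The quantifier over atoms is instantiated at the code of the disjunction itself; the
    -- introduction rules supply the two implications.
    refine ⟨fun h => h _ x le_rfl (le_inf ?_ ?_), fun h p y hy hyp => ?_⟩
    · refine le_himp_iff_forall_le.2 fun y hy hyφ => ?_
      have hyn := hy.trans hx
      exact apply_rule (.orI₁ hχ) hyn (by simpa using (ihφ hφ hyn).1 hyφ)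
    · refine le_himp_iff_forall_le.2 fun y hy hyψ => ?_
      have hyn := hy.trans hx
      exact apply_rule (.orI₂ hχ) hyn (by simpa using (ihψ hψ hyn).1 hyψ)
    · have hyn := hy.trans hx
      obtain ⟨hyφ, hyψ⟩ := le_inf_iff.1 hyp
      refine apply_rule (.orE p hχ) hyn ?_
      simp only [iInf_mem_cons, Finset.notMem_empty, iInf_false, iInf_top, top_himp,
        Finset.mem_singleton, iInf_iInf_eq_left, List.not_mem_nil, inf_top_eq]
      refine le_inf (hy.trans h) (le_inf ?_ ?_)
      · exact le_himp_iff_forall_le.2 fun z hz hzφ =>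
          le_himp_iff_forall_le.1 hyφ z hz ((ihφ hφ (hz.trans hyn)).2 hzφ)
      · exact le_himp_iff_forall_le.2 fun z hz hzψ =>
          le_himp_iff_forall_le.1 hyψ z hz ((ihψ hψ (hz.trans hyn)).2 hzψ)

/-- A valuation of the atoms is generic if every base is valid at some element of the frame at
which no further consequences between atoms hold. -/
def IsGeneric {K : Type*} [Order.Frame K] (u : Atom → K) : Prop :=
  ∀ B : Base Atom, ∃ n : K, (∀ R ∈ B, n ≤ ruleVal u R) ∧
    ∀ (P : Finset Atom) (q : Atom), n ⊓ ⨅ a ∈ P, u a ≤ u q → Entails B P q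

/-- A sequent that is valid under a generic valuation is valid under every valuation. -/
theorem IsGeneric.iInf_interp_le [Infinite Atom] {K H : Type*} [Order.Frame K] [Order.Frame H]
    {u : Atom → K} (hu : IsGeneric u) (v : Atom → H) {Γ : Finset (Formula Atom)}
    {φ : Formula Atom} (h : ⨅ ψ ∈ Γ, interp u ψ ≤ interp u φ) :
    ⨅ ψ ∈ Γ, interp v ψ ≤ interp v φ := by
  classical
  obtain ⟨T, hTf, hT, hmem⟩ := exists_finite_subClosed_superset (insert φ Γ)
  have hφ : φ ∈ T := hmem _ (Finset.mem_insert_self _ _)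
  have hΓ {ψ} (hψ : ψ ∈ Γ) : ψ ∈ T := hmem _ (Finset.mem_insert_of_mem hψ)
  obtain ⟨e, d, hd, he⟩ := exists_encoding hTf
  obtain ⟨n, hn, hent⟩ := hu (SimRule e T)
  -- Validity under `u`, read through the codes below `n`, becomes derivability by genericity.
  have key : Entails (SimRule e T) (Γ.image e : Finset Atom) (e φ) := by
    refine hent _ _ ((le_interp_iff_le_encode hT he hn hφ inf_le_left).1 (le_trans ?_ h))
    refine le_iInf₂ fun ψ hψ => ?_
    rw [le_interp_iff_le_encode hT he hn (hΓ hψ) inf_le_left]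
    exact inf_le_right.trans (iInf₂_le _ (Finset.mem_image_of_mem e hψ))
  have := inf_iInf_le_of_entails (v := fun a => interp v (d a)) (n := ⊤)
    (fun R hR => (ruleVal_decode_eq_top v hT hd hR).ge) key
  rw [top_inf_eq, hd φ hφ] at this
  refine le_trans (le_iInf₂ fun a ha => ?_) this
  obtain ⟨ψ, hψ, rfl⟩ := Finset.mem_image.1 (Finset.mem_coe.1 ha)
  rw [hd ψ (hΓ hψ)]
  exact iInf₂_le ψ hψ

end Simulation

/-! ### Base-extension validity as an interpretation in a frame -/

section BaseExtension

variable {Atom : Type u}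

/-- This is the Kripke clause for implication; for bases under reverse inclusion, `y ≤ x` says that
`y` extends `x`. -/
theorem mem_himp_iff {α : Type*} [Preorder α] {s t : LowerSet α} {x : α} :
    x ∈ s ⇨ t ↔ ∀ y ≤ x, y ∈ s → y ∈ t := by
  rw [← LowerSet.Iic_le, le_himp_iff]
  exact ⟨fun h y hy hys => h ⟨hy, hys⟩, fun h y hy => h y hy.1 hy.2⟩

/-- The bases in which an atom is derivable, as a lower set for reverse inclusion. -/
def baseVal (p : Atom) : LowerSet (Base Atom)ᵒᵈ where
  carrier := {B | Entails (OrderDual.ofDual B) ∅ p}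
  lower' _ _ h hB := hB.weaken h subset_rfl

theorem mem_baseVal {B : Base Atom} {p : Atom} :
    OrderDual.toDual B ∈ baseVal p ↔ Entails B ∅ p := Iff.rfl

/-- The clauses agree one by one. For `∨`, uncurrying the nested implications merges two successive
base extensions into the single `C`. -/
theorem mem_interp_baseVal (φ : Formula Atom) (B : Base Atom) :
    OrderDual.toDual B ∈ interp baseVal φ ↔ ValidIn φ B := by
  induction φ generalizing B with
  | atom p => rfl
  | bot => simp only [interp, LowerSet.mem_iInf_iff, ValidIn, mem_baseVal]
  | and φ ψ ihφ ihψ => simp only [interp, LowerSet.mem_inf_iff, ValidIn, ihφ, ihψ]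
  | imp φ ψ ihφ ihψ =>
    simp only [interp, mem_himp_iff, ValidIn, OrderDual.forall, OrderDual.toDual_le_toDual, ihφ,
      ihψ]
  | or φ ψ ihφ ihψ =>
    simp only [interp, mem_himp_iff, himp_himp, LowerSet.mem_iInf_iff, LowerSet.mem_inf_iff,
      ValidIn, OrderDual.forall, OrderDual.toDual_le_toDual, ihφ, ihψ, mem_baseVal, and_imp]

/-- The element for `B` is the set of all extensions of `B`. Both conditions are tested at an
extension by facts, which are then traded for hypotheses. -/
theorem isGeneric_baseVal : IsGeneric (baseVal (Atom := Atom)) := by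
  refine fun B => ⟨LowerSet.Iic (OrderDual.toDual B), fun R hR => ?_, fun P q h => ?_⟩
  · rw [LowerSet.Iic_le, ruleVal, mem_himp_iff]
    intro C hC h
    refine Entails.app R (hC hR) fun i => ?_
    rw [Set.empty_union]
    simp only [LowerSet.mem_iInf_iff, mem_himp_iff] at h
    have := h _ (List.get_mem R.prems i)
      (OrderDual.toDual (OrderDual.ofDual C ∪ Base.facts ((R.prems.get i).1 : Set Atom)))
      Set.subset_union_left fun a ha => Entails.of_mem_facts ha
    simpa using Entails.of_union_facts this
  · have hmem : OrderDual.toDual (B ∪ Base.facts (P : Set Atom)) ∈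
        LowerSet.Iic (OrderDual.toDual B) ⊓ ⨅ a ∈ P, baseVal a := by
      refine ⟨Set.subset_union_left, ?_⟩
      simp only [SetLike.mem_coe, LowerSet.mem_iInf_iff]
      exact fun a ha => Entails.of_mem_facts ha
    simpa using Entails.of_union_facts (h hmem)

theorem valid_iff_iInf_interp_le (Γ : Finset (Formula Atom)) (φ : Formula Atom) :
    Valid Γ φ ↔ ⨅ ψ ∈ Γ, interp baseVal ψ ≤ interp baseVal φ := by
  simp only [Valid, ← mem_interp_baseVal]
  refine ⟨fun h B hB => h (OrderDual.ofDual B) ?_, fun h B hB => h ?_⟩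
  · simpa only [SetLike.mem_coe, LowerSet.mem_iInf_iff] using! hB
  · simpa only [SetLike.mem_coe, LowerSet.mem_iInf_iff] using hB

end BaseExtension

/-! ### Extension of worlds by variables -/

section Worlds

variable {Atom : Type u}

/-- The variables of the first part of a context. -/
def Var.inl {L : List Atom} {p : Atom} (X : Ctx Atom) : Var L p → Var (L ++ X) p
  | .zero => .zero
  | .succ x => .succ (x.inl X)

/-- The variables of the second part of a context. -/
def Var.inr {X : Ctx Atom} {p : Atom} : (L : List Atom) → Var X p → Var (L ++ X) p
  | [], x => x
  | _ :: L, x => .succ (x.inr L)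

theorem Subn.lift_inl {B : Base Atom} {L : List Atom} {X Y : Ctx Atom} (σ : Subn B X Y) {p : Atom}
    (x : Var L p) : Subn.lift L σ p (x.inl X) = .var (x.inl Y) := by
  induction x with
  | zero => rfl
  | succ x ih => exact congrArg (fun Ψ => Der.rename Ψ _) ih

theorem Subn.lift_inr {B : Base Atom} (L : List Atom) {X Y : Ctx Atom} (σ : Subn B X Y) {p : Atom}
    (x : Var X p) : Subn.lift L σ p (x.inr L) = (σ p x).subst fun _ y => .var (y.inr L) := by
  induction L with
  | nil => exact (Der.subst_var _).symm
  | cons q L ih =>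
    refine (congrArg (fun Ψ => Der.rename Ψ _) ih).trans ?_
    rw [Der.rename_subst]
    rfl

/-- The world with further variables, one for each entry of `L`. -/
def World.extend (L : List Atom) (w : World Atom) : World Atom := ⟨w.base, L ++ w.ctx⟩

/-- Forgetting the further variables. -/
def World.proj (L : List Atom) (w : World Atom) : w.extend L ⟶ w :=
  ⟨subset_rfl, fun _ x => .var (x.inr L)⟩

/-- The action of `World.extend` on morphisms. -/
def World.extendMap (L : List Atom) {v w : World Atom} (f : v ⟶ w) : v.extend L ⟶ w.extend L :=
  ⟨f.incl, Subn.lift L f.ders⟩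

theorem World.extendMap_proj (L : List Atom) {v w : World Atom} (f : v ⟶ w) :
    World.extendMap L f ≫ w.proj L = v.proj L ≫ f := by
  apply World.Hom.ext
  funext p x
  change Subn.lift L f.ders p (x.inr L) =
    (Der.mono _ (f.ders p x)).subst fun _ y => .var (y.inr L)
  exact (Subn.lift_inr L _ x).trans
    (congrArg (fun Ψ => Der.subst Ψ _) (Der.mono_self _ (f.ders p x)).symm)

end Worlds

/-! ### Categorical validity as an interpretation in a frame -/

section Presheaves

variable {Atom : Type u}

namespace Psh

/-- Evaluation of an element of an exponential along a morphism. -/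
def evalAt {F G : Psh Atom} {w : (World Atom)ᵒᵖ} (α : (exp F G).obj w) {v : (World Atom)ᵒᵖ}
    (f : v.unop ⟶ w.unop) (y : F.obj v) : G.obj v :=
  NatTrans.app (F := FunctorToTypes.prod (yoneda.obj w.unop) F) α v
    (Prod.mk (α := v.unop ⟶ w.unop) f y)

theorem map_evalAt {F G : Psh Atom} {w : (World Atom)ᵒᵖ} (α : (exp F G).obj w)
    {v v' : (World Atom)ᵒᵖ} (f : v.unop ⟶ w.unop) (y : F.obj v) (g : v ⟶ v') :
    G.map g (evalAt α f y) = evalAt α (g.unop ≫ f) (F.map g y) := by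
  let z : (FunctorToTypes.prod (yoneda.obj w.unop) F).obj v := Prod.mk (α := v.unop ⟶ w.unop) f y
  exact (NatTrans.naturality_apply (F := FunctorToTypes.prod (yoneda.obj w.unop) F) α g z).symm

/-- Modus ponens for presheaves. -/
def eval {H F G : Psh Atom} (α : H ⟶ exp F G) (β : H ⟶ F) : H ⟶ G where
  app w := TypeCat.ofHom fun x => evalAt (α.app w x) (𝟙 w.unop) (β.app w x)
  naturality v w f := by
    ext x
    change evalAt (α.app w (H.map f x)) (𝟙 w.unop) (β.app w (H.map f x)) =
      G.map f (evalAt (α.app v x) (𝟙 v.unop) (β.app v x))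
    rw [NatTrans.naturality_apply α f x, NatTrans.naturality_apply β f x, map_evalAt]
    change evalAt (α.app v x) (𝟙 w.unop ≫ f.unop) (F.map f (β.app v x)) = _
    rw [Category.id_comp, Category.comp_id]

/-- Transposition for the exponential. -/
def curry {H F G : Psh Atom} (γ : FunctorToTypes.prod H F ⟶ G) : H ⟶ exp F G where
  app w := TypeCat.ofHom fun x =>
    FunctorToTypes.prod.lift (FunctorToTypes.prod.fst ≫ yonedaEquiv.symm x)
      FunctorToTypes.prod.snd ≫ γ
  naturality v w f := by
    ext x : 3
    change FunctorToTypes.prod.lift (FunctorToTypes.prod.fst ≫ yonedaEquiv.symm (H.map f x))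
      FunctorToTypes.prod.snd ≫ γ = FunctorToTypes.prod.lift
        (FunctorToTypes.prod.fst ≫ yoneda.map f.unop ≫ yonedaEquiv.symm x)
        FunctorToTypes.prod.snd ≫ γ
    rw [yonedaEquiv_symm_naturality_left]
    rfl

/-- Instantiation of a quantifier. -/
def allProj (K : Atom → Psh Atom) (p : Atom) : all K ⟶ K p where
  app w := TypeCat.ofHom fun α => yonedaEquiv (show yoneda.obj w.unop ⟶ K p from α p)
  naturality v w f := by
    ext α
    exact (yonedaEquiv_naturality' (show yoneda.obj v.unop ⟶ K p from α p) f).symm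

/-- Generalization. -/
def allLift {H : Psh Atom} {K : Atom → Psh Atom} (γ : ∀ p, H ⟶ K p) : H ⟶ all K where
  app w := TypeCat.ofHom fun x p => yonedaEquiv.symm x ≫ γ p
  naturality v w f := by
    ext x : 3
    funext p
    change yonedaEquiv.symm (H.map f x) ≫ γ p = yoneda.map f.unop ≫ yonedaEquiv.symm x ≫ γ p
    rw [← Category.assoc, yonedaEquiv_symm_naturality_left]
    rfl

/-- The projections of a product. -/
def piProj {ι : Type u} (F : ι → Psh Atom) (i : ι) : pi F ⟶ F i where
  app _ := TypeCat.ofHom fun a => a i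

/-- The universal property of a product. -/
def piLift {ι : Type u} {H : Psh Atom} {F : ι → Psh Atom} (γ : ∀ i, H ⟶ F i) : H ⟶ pi F where
  app w := TypeCat.ofHom fun x i => (γ i).app w x
  naturality v w f := by
    ext x : 3
    funext i
    exact NatTrans.naturality_apply (γ i) f x

/-- The generic elements of a finite set `P` of atoms after extension by `P`. -/
def newVars (P : Finset Atom) (w : World Atom) :
    (pi fun a : {a // a ∈ P} => atom a.1).obj (op (w.extend P.toList)) :=
  fun a => .var ((Var.nonempty_of_mem (Finset.mem_toList.2 a.2)).some.inl w.ctx)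

theorem map_newVars (P : Finset Atom) {v w : World Atom} (f : v ⟶ w) :
    (pi fun a : {a // a ∈ P} => atom a.1).map (World.extendMap P.toList f).op (newVars P w) =
      newVars P v := by
  funext a
  exact Subn.lift_inl _ _

/-- The premise of a rule obtained from an element of an exponential. -/
def premise {P : Finset Atom} {q : Atom} {w : World Atom}
    (α : (exp (pi fun a : {a // a ∈ P} => atom a.1) (atom q)).obj (op w)) :
    Der w.base (P.toList ++ w.ctx) q :=
  evalAt (v := op (w.extend P.toList)) α (w.proj P.toList) (newVars P w)

/-- Evaluation is natural, and a lifted substitution fixes the new variables and commutes with the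
projections. The result is substitution under a binder, exactly what naturality of `applyRule`
requires. -/
theorem premise_map {P : Finset Atom} {q : Atom} {v w : World Atom} (f : v ⟶ w)
    (α : (exp (pi fun a : {a // a ∈ P} => atom a.1) (atom q)).obj (op w)) :
    premise ((exp (pi fun a : {a // a ∈ P} => atom a.1) (atom q)).map f.op α) =
      ((premise α).mono f.incl).subst (Subn.lift P.toList f.ders) := by
  refine Eq.trans ?_ (map_evalAt (v := op (w.extend P.toList)) α (w.proj P.toList) (newVars P w)
    (World.extendMap P.toList f).op).symm
  rw [map_newVars]
  change evalAt (v := op (v.extend P.toList)) α (v.proj P.toList ≫ f) (newVars P v) =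
    evalAt (v := op (v.extend P.toList)) α (World.extendMap P.toList f ≫ w.proj P.toList)
      (newVars P v)
  rw [World.extendMap_proj]

/-- Application of a rule of a base to its premises. -/
def applyRule {B : Base Atom} {R : AtomicRule Atom} (hR : R ∈ B) {F : Psh Atom}
    (ν : F ⟶ yoneda.obj ⟨B, []⟩)
    (σ : ∀ i : Fin R.prems.length, F ⟶ exp (pi fun a : {a // a ∈ (R.prems.get i).1} => atom a.1)
      (atom (R.prems.get i).2)) : F ⟶ atom R.concl where
  app w := TypeCat.ofHom fun x =>
    Der.app R ((show w.unop ⟶ ⟨B, []⟩ from ν.app w x).incl hR) fun i =>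
      premise ((σ i).app w x)
  naturality v w f := by
    ext x
    change Der.app R _ _ = Der.app R _ _
    congr 1
    funext i
    refine Eq.trans ?_ (premise_map f.unop ((σ i).app v x))
    exact congrArg premise (NatTrans.naturality_apply (σ i) f x)

end Psh

/-- Presheaves, preordered by the existence of a natural transformation. -/
structure PshOrder (Atom : Type u) : Type (u + 1) where
  psh : Psh Atom

instance : Preorder (PshOrder Atom) where
  le F G := Nonempty (F.psh ⟶ G.psh)
  le_refl F := ⟨𝟙 F.psh⟩
  le_trans _ _ _ := fun ⟨α⟩ ⟨β⟩ => ⟨α ≫ β⟩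

/-- The principal lower set of a presheaf. -/
def below (F : Psh Atom) : LowerSet (PshOrder Atom) := LowerSet.Iic ⟨F⟩

theorem below_le_below {F G : Psh Atom} : below F ≤ below G ↔ Nonempty (F ⟶ G) :=
  LowerSet.Iic_le

theorem below_prod (F G : Psh Atom) : below (FunctorToTypes.prod F G) = below F ⊓ below G := by
  refine le_antisymm (le_inf ?_ ?_) ?_
  · exact below_le_below.2 ⟨FunctorToTypes.prod.fst⟩
  · exact below_le_below.2 ⟨FunctorToTypes.prod.snd⟩
  · rintro H ⟨⟨α⟩, ⟨β⟩⟩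
    exact ⟨FunctorToTypes.prod.lift α β⟩

/-- Transposition and evaluation suffice; their uniqueness laws are invisible in the preorder. -/
theorem below_exp (F G : Psh Atom) : below (Psh.exp F G) = below F ⇨ below G := by
  refine le_antisymm (le_himp_iff.2 ?_) fun H hH => ?_
  · rintro H ⟨⟨α⟩, ⟨β⟩⟩
    exact ⟨Psh.eval α β⟩
  · obtain ⟨γ⟩ := mem_himp_iff.1 hH ⟨FunctorToTypes.prod H.psh F⟩
      ⟨FunctorToTypes.prod.fst⟩ ⟨FunctorToTypes.prod.snd⟩
    exact ⟨Psh.curry γ⟩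

theorem below_all (K : Atom → Psh Atom) : below (Psh.all K) = ⨅ p, below (K p) := by
  refine le_antisymm (le_iInf fun p => below_le_below.2 ⟨Psh.allProj K p⟩) fun H hH => ?_
  simp only [SetLike.mem_coe, LowerSet.mem_iInf_iff] at hH
  -- Each atom gives only the existence of a transformation; choice assembles a family.
  exact ⟨Psh.allLift fun p => (hH p).some⟩

theorem below_pi {ι : Type u} (F : ι → Psh Atom) : below (Psh.pi F) = ⨅ i, below (F i) := by
  refine le_antisymm (le_iInf fun i => below_le_below.2 ⟨Psh.piProj F i⟩) fun H hH => ?_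
  simp only [SetLike.mem_coe, LowerSet.mem_iInf_iff] at hH
  exact ⟨Psh.piLift fun i => (hH i).some⟩

/-- The valuation of atoms by presheaves of derivations. -/
def pshVal (p : Atom) : LowerSet (PshOrder Atom) := below (Psh.atom p)

theorem below_sem (φ : Formula Atom) : below (sem φ) = interp pshVal φ := by
  induction φ with
  | atom p => rfl
  | bot => exact below_all _
  | and φ ψ ihφ ihψ => rw [sem, below_prod, ihφ, ihψ, interp]
  | imp φ ψ ihφ ihψ => rw [sem, below_exp, ihφ, ihψ, interp]
  | or φ ψ ihφ ihψ =>
    rw [sem, below_all, interp]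
    simp only [below_exp, ihφ, ihψ, pshVal]

theorem catValid_iff_iInf_interp_le (Γ : Finset (Formula Atom)) (φ : Formula Atom) :
    CatValid Γ φ ↔ ⨅ ψ ∈ Γ, interp pshVal ψ ≤ interp pshVal φ := by
  rw [CatValid, ← below_le_below, semCtx, below_pi]
  simp only [below_sem, iInf_subtype]

/-- The element for `B` is the representable of `B` with empty context: a map from `F` to it says
that `F` is inhabited only at worlds whose base contains `B`, so the rules of `B` can be applied
there. Conversely, by Yoneda, a map from the representable of `(B, P)` to the presheaf of `q` is a
derivation of `q` from `P` in `B`. -/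
theorem isGeneric_pshVal : IsGeneric (pshVal (Atom := Atom)) := by
  refine fun B => ⟨below (yoneda.obj ⟨B, []⟩), fun R hR => ?_, fun P q h => ?_⟩
  · rw [ruleVal, le_himp_iff]
    rintro F ⟨⟨ν⟩, hF⟩
    have hσ (i : Fin R.prems.length) : F ∈ below (Psh.exp
        (Psh.pi fun a : {a // a ∈ (R.prems.get i).1} => Psh.atom a.1)
        (Psh.atom (R.prems.get i).2)) := by
      simp only [SetLike.mem_coe, LowerSet.mem_iInf_iff] at hF
      have := hF _ (List.get_mem R.prems i)
      rw [iInf_subtype'] at this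
      rwa [below_exp, below_pi]
    exact ⟨Psh.applyRule hR ν fun i => (hσ i).some⟩
  · have hmem : (⟨yoneda.obj ⟨B, P.toList⟩⟩ : PshOrder Atom) ∈
        below (yoneda.obj ⟨B, []⟩) ⊓ ⨅ a ∈ P, pshVal a := by
      -- A morphism into the empty context has no derivations to supply.
      refine ⟨⟨yoneda.map ⟨subset_rfl, fun _ x => nomatch x⟩⟩, ?_⟩
      simp only [SetLike.mem_coe, LowerSet.mem_iInf_iff]
      exact fun a ha => ⟨yonedaEquiv.symm (Der.var
        (Var.nonempty_of_mem (Finset.mem_toList.2 ha)).some)⟩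
    obtain ⟨α⟩ := h hmem
    have Φ : Der B P.toList q := yonedaEquiv (F := Psh.atom q) α
    exact Φ.entails.weaken subset_rfl fun a ha => by simpa using ha

end Presheaves

end

end BaseExt

theorem mainTheorem1 {Atom : Type*} [Infinite Atom] (Γ : Finset (BaseExt.Formula Atom))
    (φ : BaseExt.Formula Atom) : BaseExt.Valid Γ φ ↔ BaseExt.CatValid Γ φ := by
  rw [BaseExt.valid_iff_iInf_interp_le, BaseExt.catValid_iff_iInf_interp_le]
  exact ⟨BaseExt.isGeneric_baseVal.iInf_interp_le _, BaseExt.isGeneric_pshVal.iInf_interp_le _⟩
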